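/- A relation algebra is an algebra $\langle A,+,\cdot,\bar{\ },0,1,;,\breve{\ },1'\rangle$ that is a Boolean algebra satisfying $r;(s;t)=(r;s);t$, $(r+s);t=r;t+s;t$, $(r+s)\breve{\ }=\breve r+\breve s$, $\breve{\breve r}=r$, $r;1'=r$, $(r;s)\breve{\ }=\breve s;\breve r$ and $(r;s)\cdot t\le (r\cdot (t;\breve s));(s\cdot(\breve r;t))$. A proper relation algebra is one whose elements are binary relations on a set $U$, containing $\emptyset$, the identity of $U$ and a largest relation $E$, and closed under union, intersection, complement relative to $E$, composition and converse, with these as its operations; a relation algebra is representable if it is isomorphic to a proper one. An element $x$ is an ideal element if $x=1;x;1$. $\mathbf 2$ denotes the two-element relation algebra. A relation algebra is prime if it is simple (its only congruences are equality and the total one) and is isomorphic neither to the one-element algebra nor to $\mathbf 2$. The fork index $\varphi(\mathcal A)$ is the number of binary operations $\nabla$ on $A$ satisfying $r\nabla s=(r;(1'\nabla 1))\cdot(s;(1\nabla 1'))$, $(r\nabla s);(t\nabla u)\breve{\ }=(r;\breve t)\cdot(s;\breve u)$ and $(1'\nabla 1)\breve{\ }\,\nabla\,(1\nabla 1')\breve{\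 }\le 1'$; $\mathcal A$ is explosive if $\varphi(\mathcal A)=|A|^2$. Theorem. Let $\kappa$ be an infinite cardinal. (1) There are $\kappa$ pairwise non-isomorphic explosive proper relation algebras of cardinality $\kappa$. (2) There is a prime explosive proper relation algebra of cardinality $\kappa$. Let $\mathcal R_\kappa$ be any such algebra. For every cardinal $\zeta<\kappa$ the product $\mathbf 2^\zeta\times\mathcal R_\kappa$ is representable, has exactly $2^{\zeta+1}$ ideal elements and has fork index $\kappa$; if moreover $2^\zeta\le\kappa$, then it has cardinality $\kappa$ and is explosive. For distinct cardinals $\zeta,\zeta'<\kappa$ the algebras $\mathbf 2^{\zeta}\times\mathcal R_\kappa$ and $\mathbf 2^{\zeta'}\times\mathcal R_\kappa$ are not isomorphic. -/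

import Mathlib

open Cardinal
open scoped SetRel

universe u v

/-- A relation algebra, in the equational axiomatisation: a Boolean algebra with a relative
product `comp`, a converse `conv` and an identity `ide`; the last axiom is the Dedekind formula. -/
class RelationAlgebra (A : Type u) extends BooleanAlgebra A where
  comp : A → A → A
  conv : A → A
  ide : A
  comp_assoc : ∀ r s t : A, comp r (comp s t) = comp (comp r s) t
  sup_comp : ∀ r s t : A, comp (r ⊔ s) t = comp r t ⊔ comp s t
  conv_sup : ∀ r s : A, conv (r ⊔ s) = conv r ⊔ conv s
  conv_conv : ∀ r : A, conv (conv r) = r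
  comp_ide : ∀ r : A, comp r ide = r
  conv_comp : ∀ r s : A, conv (comp r s) = comp (conv s) (conv r)
  dedekind : ∀ r s t : A,
    comp r s ⊓ t ≤ comp (r ⊓ comp t (conv s)) (s ⊓ comp (conv r) t)

namespace RelationAlgebra

/-- An isomorphism of relation algebras: an order isomorphism (hence it preserves the Boolean
operations) that preserves relative product, converse and identity. -/
structure Iso (A : Type u) (B : Type v) [RelationAlgebra A] [RelationAlgebra B]
    extends A ≃o B where
  map_comp : ∀ x y : A, toFun (comp x y) = comp (toFun x) (toFun y)
  map_conv : ∀ x : A, toFun (conv x) = conv (toFun x)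
  map_ide : toFun (ide : A) = ide

/-- Two relation algebras are isomorphic. -/
def Isomorphic (A : Type u) (B : Type v) [RelationAlgebra A] [RelationAlgebra B] : Prop :=
  Nonempty (Iso A B)

/-- The one-element relation algebra. -/
instance instPUnit : RelationAlgebra PUnit.{u + 1} where
  comp _ _ := PUnit.unit
  conv _ := PUnit.unit
  ide := PUnit.unit
  comp_assoc _ _ _ := rfl
  sup_comp _ _ _ := rfl
  conv_sup _ _ := rfl
  conv_conv _ := rfl
  comp_ide _ := rfl
  conv_comp _ _ := rfl
  dedekind _ _ _ := le_rfl

/-- The two-element relation algebra. -/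
instance instBool : RelationAlgebra Bool where
  comp x y := x ⊓ y
  conv x := x
  ide := ⊤
  comp_assoc := by decide
  sup_comp := by decide
  conv_sup := by decide
  conv_conv := by decide
  comp_ide := by decide
  conv_comp := by decide
  dedekind := by decide

/-- The direct power of a relation algebra, with pointwise operations. -/
instance instPi (Z : Type v) (A : Type u) [RelationAlgebra A] : RelationAlgebra (Z → A) where
  comp x y := fun z => comp (x z) (y z)
  conv x := fun z => conv (x z)
  ide := fun _ => ide
  comp_assoc r s t := funext fun z => comp_assoc (r z) (s z) (t z)
  sup_comp r s t := funext fun z => sup_comp (r z) (s z) (t z)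
  conv_sup r s := funext fun z => conv_sup (r z) (s z)
  conv_conv r := funext fun z => conv_conv (r z)
  comp_ide r := funext fun z => comp_ide (r z)
  conv_comp r s := funext fun z => conv_comp (r z) (s z)
  dedekind r s t := fun z => dedekind (r z) (s z) (t z)

/-- The direct product of two relation algebras, with componentwise operations. -/
instance instProd (A : Type u) (B : Type v) [RelationAlgebra A] [RelationAlgebra B] :
    RelationAlgebra (A × B) where
  comp x y := (comp x.1 y.1, comp x.2 y.2)
  conv x := (conv x.1, conv x.2)
  ide := (ide, ide)
  comp_assoc r s t := Prod.ext (comp_assoc r.1 s.1 t.1) (comp_assoc r.2 s.2 t.2)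
  sup_comp r s t := Prod.ext (sup_comp r.1 s.1 t.1) (sup_comp r.2 s.2 t.2)
  conv_sup r s := Prod.ext (conv_sup r.1 s.1) (conv_sup r.2 s.2)
  conv_conv r := Prod.ext (conv_conv r.1) (conv_conv r.2)
  comp_ide r := Prod.ext (comp_ide r.1) (comp_ide r.2)
  conv_comp r s := Prod.ext (conv_comp r.1 s.1) (conv_comp r.2 s.2)
  dedekind r s t := ⟨dedekind r.1 s.1 t.1, dedekind r.2 s.2 t.2⟩

section Notions

variable (A : Type u) [RelationAlgebra A]

/-- The set of ideal elements `x = 1 ; x ; 1`. -/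
def idealElements : Set A := {x | x = comp (comp ⊤ x) ⊤}

/-- A congruence: an equivalence relation compatible with all operations. -/
structure IsCongruence (θ : A → A → Prop) : Prop where
  equivalence : Equivalence θ
  sup : ∀ {x x' y y' : A}, θ x x' → θ y y' → θ (x ⊔ y) (x' ⊔ y')
  inf : ∀ {x x' y y' : A}, θ x x' → θ y y' → θ (x ⊓ y) (x' ⊓ y')
  compl : ∀ {x x' : A}, θ x x' → θ xᶜ x'ᶜ
  comp : ∀ {x x' y y' : A}, θ x x' → θ y y' →
    θ (RelationAlgebra.comp x y) (RelationAlgebra.comp x' y')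
  conv : ∀ {x x' : A}, θ x x' → θ (RelationAlgebra.conv x) (RelationAlgebra.conv x')

/-- Simple, in the sense of universal algebra: the only congruences are equality and the total
relation. -/
def Simple : Prop :=
  ∀ θ : A → A → Prop, IsCongruence A θ → (∀ x y, θ x y ↔ x = y) ∨ (∀ x y, θ x y)

/-- Trivial: isomorphic to the one-element or to the two-element relation algebra. -/
def Trivial : Prop := Isomorphic A PUnit.{1} ∨ Isomorphic A Bool

/-- Prime: simple and not trivial. -/
def Prime : Prop := Simple A ∧ ¬ Trivial A

/-- A fork operation on a relation algebra, i.e. an expansion of it to a fork algebra. -/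
@[ext]
structure ForkExpansion where
  fork : A → A → A
  fork_eq : ∀ r s : A, fork r s = comp r (fork ide ⊤) ⊓ comp s (fork ⊤ ide)
  fork_comp_conv : ∀ r s t w : A,
    comp (fork r s) (conv (fork t w)) = comp r (conv t) ⊓ comp s (conv w)
  fork_proj_le : fork (conv (fork ide ⊤)) (conv (fork ⊤ ide)) ≤ ide

/-- The fork index: the number of expansions to a fork algebra. -/
def forkIndex : Cardinal.{u} := #(ForkExpansion A)

/-- Explosive: the fork index is the square of the cardinality of the algebra. -/
def Explosive : Prop := forkIndex A = #A ^ 2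

end Notions

end RelationAlgebra

/-- A proper relation algebra on the set `U`: a set of binary relations on `U`, containing `∅`, the
identity relation and a greatest relation `unit`, and closed under union, intersection, complement
relative to `unit`, composition and converse. -/
structure ProperRelationAlgebra (U : Type u) where
  carrier : Set (SetRel U U)
  unit : SetRel U U
  unit_mem : unit ∈ carrier
  subset_unit : ∀ r ∈ carrier, r ⊆ unit
  empty_mem : (∅ : SetRel U U) ∈ carrier
  id_mem : (SetRel.id : SetRel U U) ∈ carrier
  union_mem : ∀ r ∈ carrier, ∀ s ∈ carrier, r ∪ s ∈ carrier
  inter_mem : ∀ r ∈ carrier, ∀ s ∈ carrier, r ∩ s ∈ carrier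
  diff_mem : ∀ r ∈ carrier, unit \ r ∈ carrier
  comp_mem : ∀ r ∈ carrier, ∀ s ∈ carrier, r ○ s ∈ carrier
  inv_mem : ∀ r ∈ carrier, r.inv ∈ carrier

namespace ProperRelationAlgebra

instance instCoeSort (U : Type u) : CoeSort (ProperRelationAlgebra U) (Type u) :=
  ⟨fun P => P.carrier⟩

instance instBooleanAlgebra {U : Type u} (P : ProperRelationAlgebra U) :
    BooleanAlgebra P where
  le r s := r.1 ⊆ s.1
  le_refl _ := subset_rfl
  le_trans _ _ _ h₁ h₂ := h₁.trans h₂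
  le_antisymm _ _ h₁ h₂ := Subtype.ext (h₁.antisymm h₂)
  sup r s := ⟨r.1 ∪ s.1, P.union_mem _ r.2 _ s.2⟩
  le_sup_left _ _ := Set.subset_union_left
  le_sup_right _ _ := Set.subset_union_right
  sup_le _ _ _ h₁ h₂ := Set.union_subset h₁ h₂
  inf r s := ⟨r.1 ∩ s.1, P.inter_mem _ r.2 _ s.2⟩
  inf_le_left _ _ := Set.inter_subset_left
  inf_le_right _ _ := Set.inter_subset_right
  le_inf _ _ _ h₁ h₂ := Set.subset_inter h₁ h₂
  le_sup_inf r s t := (Set.union_inter_distrib_left r.1 s.1 t.1).symm.subset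
  compl r := ⟨P.unit \ r.1, P.diff_mem _ r.2⟩
  top := ⟨P.unit, P.unit_mem⟩
  bot := ⟨∅, P.empty_mem⟩
  inf_compl_le_bot _ := fun _ h => absurd h.1 h.2.2
  top_le_sup_compl r := fun p h => (em (p ∈ r.1)).imp id fun h' => ⟨h, h'⟩
  le_top r := P.subset_unit _ r.2
  bot_le _ := Set.empty_subset _

/-- The relation algebra given by a proper relation algebra: composition, converse and identity are
the set-theoretic ones. -/
instance instRelationAlgebra {U : Type u} (P : ProperRelationAlgebra U) :
    RelationAlgebra P where
  comp r s := ⟨r.1 ○ s.1, P.comp_mem _ r.2 _ s.2⟩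
  conv r := ⟨r.1.inv, P.inv_mem _ r.2⟩
  ide := ⟨SetRel.id, P.id_mem⟩
  comp_assoc r s t := Subtype.ext (SetRel.comp_assoc r.1 s.1 t.1).symm
  sup_comp _ _ _ := Subtype.ext <| Set.ext fun _ =>
    ⟨fun ⟨b, h, h'⟩ => h.imp (fun h => ⟨b, h, h'⟩) (fun h => ⟨b, h, h'⟩),
      fun h => h.elim (fun ⟨b, h, h'⟩ => ⟨b, Or.inl h, h'⟩) (fun ⟨b, h, h'⟩ => ⟨b, Or.inr h, h'⟩)⟩
  conv_sup _ _ := rfl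
  conv_conv _ := rfl
  comp_ide r := Subtype.ext (SetRel.comp_id r.1)
  conv_comp r s := Subtype.ext (SetRel.inv_comp r.1 s.1)
  dedekind _ _ _ := fun p ⟨⟨b, h, h'⟩, ht⟩ =>
    ⟨b, ⟨h, p.2, ht, h'⟩, ⟨h', p.1, h, ht⟩⟩

end ProperRelationAlgebra

namespace RelationAlgebra

/-- Representable: isomorphic to a proper relation algebra. -/
def Representable (A : Type u) [RelationAlgebra A] : Prop :=
  ∃ (U : Type u) (P : ProperRelationAlgebra U), Isomorphic A P

end RelationAlgebra

/-! A fork is determined by its projections `1' ∇ 1` and `1 ∇ 1'`, so the fork index is at most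
|A|², which equals |A| for infinite A. Being explosive then means having at least as many forks as
elements.

Let |U| = κ. Each injective pairing of U × U into U defines a fork on any algebra of relations with
unit U × U that contains its two projections, and distinct pairings give distinct forks
(`mk_le_forkIndex`). Closing κ such pairs of projections under the operations gives κ relations,
hence an explosive algebra, which is simple because its unit is U × U. To obtain many types, the
generators also include all points {(a, a)}, a well order and the diagonal of a subset S. An
isomorphism permutes the points; if it fixes the well order it fixes every point, hence every
relation (`iso_eq_of_fixes_wellOrder`). So each isomorphism type arises from at most κ of the 2^κ
subsets S, and there are at least κ types.

In the product 2^Z × R the Boolean component of a fork must be the meet, so the fork index is that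
of R. The ideal elements form the power set of Z plus one point, from which |Z| is recovered by
counting atoms. The product acts on the disjoint union of Z and U. -/

namespace RelationAlgebra

/-! ### Isomorphisms -/

namespace Iso

variable {A B C : Type*} [RelationAlgebra A] [RelationAlgebra B] [RelationAlgebra C]

theorem apply_comp (f : Iso A B) (x y : A) :
    f.toRelIso (comp x y) = comp (f.toRelIso x) (f.toRelIso y) := f.map_comp x y

theorem apply_conv (f : Iso A B) (x : A) : f.toRelIso (conv x) = conv (f.toRelIso x) :=
  f.map_conv x

theorem apply_ide (f : Iso A B) : f.toRelIso (ide : A) = ide := f.map_ide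

/-- The identity isomorphism. -/
def refl (A : Type*) [RelationAlgebra A] : Iso A A where
  toRelIso := OrderIso.refl A
  map_comp _ _ := rfl
  map_conv _ := rfl
  map_ide := rfl

/-- The inverse of an isomorphism. -/
def symm (f : Iso A B) : Iso B A where
  toRelIso := OrderIso.symm f.toRelIso
  map_comp x y := f.toRelIso.injective <| by
    change f.toRelIso (f.toRelIso.symm _) = f.toRelIso (comp (f.toRelIso.symm x) (f.toRelIso.symm y))
    rw [apply_comp]; simp
  map_conv x := f.toRelIso.injective <| by
    change f.toRelIso (f.toRelIso.symm _) = f.toRelIso (conv (f.toRelIso.symm x))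
    rw [apply_conv]; simp
  map_ide := f.toRelIso.injective <| by
    change f.toRelIso (f.toRelIso.symm _) = f.toRelIso ide
    rw [apply_ide]; simp

/-- The composite of two isomorphisms. -/
def trans (f : Iso A B) (g : Iso B C) : Iso A C where
  toRelIso := OrderIso.trans f.toRelIso g.toRelIso
  map_comp x y := by
    change g.toRelIso (f.toRelIso _) = comp (g.toRelIso (f.toRelIso x)) (g.toRelIso (f.toRelIso y))
    rw [apply_comp, apply_comp]
  map_conv x := by
    change g.toRelIso (f.toRelIso _) = conv (g.toRelIso (f.toRelIso x))
    rw [apply_conv, apply_conv]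
  map_ide := by
    change g.toRelIso (f.toRelIso _) = ide
    rw [apply_ide, apply_ide]

theorem apply_bot (f : Iso A B) : f.toRelIso (⊥ : A) = ⊥ := OrderIso.map_bot (f := f.toRelIso)

theorem apply_top (f : Iso A B) : f.toRelIso (⊤ : A) = ⊤ := OrderIso.map_top (f := f.toRelIso)

end Iso

/-! ### Upper bound on the fork index -/

section ForkIndex

variable {A : Type u} [RelationAlgebra A]

/-- A fork operation is determined by the two projections `1' ∇ 1` and `1 ∇ 1'`. -/
theorem ForkExpansion.projections_injective :
    Function.Injective fun F : ForkExpansion A => (F.fork ide ⊤, F.fork ⊤ ide) := by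
  intro F G h
  obtain ⟨h₁, h₂⟩ := Prod.ext_iff.1 h
  ext r s
  rw [F.fork_eq, G.fork_eq]
  exact congr_arg₂ (· ⊓ ·) (congr_arg _ h₁) (congr_arg _ h₂)

theorem forkIndex_le : forkIndex A ≤ #A ^ 2 := by
  rw [pow_two, mul_def]
  exact mk_le_of_injective ForkExpansion.projections_injective

/-- For an algebra of infinite cardinality, it suffices to exhibit as many forks as elements. -/
theorem explosive_of_le (hA : ℵ₀ ≤ #A) (h : #A ≤ forkIndex A) : Explosive A :=
  le_antisymm forkIndex_le <| by rwa [pow_two, mul_eq_self hA]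

end ForkIndex

theorem not_trivial_of_aleph0_le {A : Type u} [RelationAlgebra A] (hA : ℵ₀ ≤ #A) : ¬ Trivial A := by
  have := infinite_iff.2 hA
  rintro (⟨⟨f⟩⟩ | ⟨⟨f⟩⟩)
  · exact not_finite_iff_infinite.2 this (Finite.of_equiv _ f.toEquiv.symm)
  · exact not_finite_iff_infinite.2 this (Finite.of_equiv _ f.toEquiv.symm)

end RelationAlgebra

namespace ProperRelationAlgebra

open RelationAlgebra

variable {U : Type u}

/-! ### Generated algebras and their cardinality -/

section Generated

/-- The relations obtained from `S` by at most one application of a relation algebra operation. -/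
def step (S : Set (SetRel U U)) : Set (SetRel U U) :=
  S ∪ (Set.image2 (· ∪ ·) S S ∪ (Set.image2 (· ∩ ·) S S ∪ (Set.image2 (· ○ ·) S S ∪
    (compl '' S ∪ SetRel.inv '' S))))

theorem subset_step (S : Set (SetRel U U)) : S ⊆ step S := Set.subset_union_left

theorem mk_step_le {κ : Cardinal.{u}} (hκ : ℵ₀ ≤ κ) {S : Set (SetRel U U)} (hS : #S ≤ κ) :
    #(step S) ≤ κ := by
  have hmul : #S * #S ≤ κ := (mul_le_mul' hS hS).trans (mul_eq_self hκ).le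
  have hun {X Y : Set (SetRel U U)} (hX : #X ≤ κ) (hY : #Y ≤ κ) : #(X ∪ Y : Set _) ≤ κ :=
    (mk_union_le X Y).trans (add_le_of_le hκ hX hY)
  exact hun hS <| hun (mk_image2_le.trans hmul) <| hun (mk_image2_le.trans hmul) <|
    hun (mk_image2_le.trans hmul) <| hun (mk_image_le.trans hS) (mk_image_le.trans hS)

/-- The closure of a set of relations under the operations of the algebra of all relations. -/
def closure (G : Set (SetRel U U)) : Set (SetRel U U) :=
  ⋃ n : ℕ, step^[n] (G ∪ {∅, Set.univ, SetRel.id})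

theorem step_monotone (G : Set (SetRel U U)) : Monotone fun n => step^[n] G :=
  fun _ _ h => Function.monotone_iterate_of_id_le subset_step h G

theorem subset_closure (G : Set (SetRel U U)) : G ∪ {∅, Set.univ, SetRel.id} ⊆ closure G :=
  Set.subset_iUnion_of_subset 0 subset_rfl

theorem closure_closed₁ {G : Set (SetRel U U)} {f : SetRel U U → SetRel U U}
    (hf : ∀ S, ∀ r ∈ S, f r ∈ step S) {r : SetRel U U} (hr : r ∈ closure G) : f r ∈ closure G := by
  obtain ⟨n, hn⟩ := Set.mem_iUnion.1 hr
  refine Set.mem_iUnion.2 ⟨n + 1, ?_⟩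
  rw [Function.iterate_succ_apply']
  exact hf _ _ hn

theorem closure_closed₂ {G : Set (SetRel U U)} {f : SetRel U U → SetRel U U → SetRel U U}
    (hf : ∀ S, ∀ r ∈ S, ∀ s ∈ S, f r s ∈ step S) {r s : SetRel U U} (hr : r ∈ closure G)
    (hs : s ∈ closure G) : f r s ∈ closure G := by
  obtain ⟨n, hn⟩ := Set.mem_iUnion.1 hr
  obtain ⟨m, hm⟩ := Set.mem_iUnion.1 hs
  -- The stages increase, so both arguments are available at stage `max n m`.
  refine Set.mem_iUnion.2 ⟨max n m + 1, ?_⟩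
  rw [Function.iterate_succ_apply']
  exact hf _ _ (step_monotone _ (le_max_left n m) hn) _ (step_monotone _ (le_max_right n m) hm)

/-- The proper relation algebra with unit `U × U` generated by a set of relations. -/
def generated (G : Set (SetRel U U)) : ProperRelationAlgebra U where
  carrier := closure G
  unit := Set.univ
  unit_mem := subset_closure G (by simp)
  subset_unit _ _ := Set.subset_univ _
  empty_mem := subset_closure G (by simp)
  id_mem := subset_closure G (by simp)
  union_mem _ hr _ hs := closure_closed₂ (f := (· ∪ ·))
    (fun _ _ hr _ hs => .inr (.inl (Set.mem_image2_of_mem hr hs))) hr hs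
  inter_mem _ hr _ hs := closure_closed₂ (f := (· ∩ ·))
    (fun _ _ hr _ hs => .inr (.inr (.inl (Set.mem_image2_of_mem hr hs)))) hr hs
  diff_mem r hr := by
    rw [← Set.compl_eq_univ_sdiff]
    exact closure_closed₁ (fun _ _ hr => .inr (.inr (.inr (.inr (.inl ⟨_, hr, rfl⟩))))) hr
  comp_mem _ hr _ hs := closure_closed₂ (f := (· ○ ·))
    (fun _ _ hr _ hs => .inr (.inr (.inr (.inl (Set.mem_image2_of_mem hr hs))))) hr hs
  inv_mem _ hr := closure_closed₁
    (fun _ _ hr => .inr (.inr (.inr (.inr (.inr ⟨_, hr, rfl⟩))))) hr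

theorem mem_generated {G : Set (SetRel U U)} {r : SetRel U U} (hr : r ∈ G) :
    r ∈ (generated G).carrier := subset_closure G (.inl hr)

theorem mk_generated_le {κ : Cardinal.{u}} (hκ : ℵ₀ ≤ κ) {G : Set (SetRel U U)} (hG : #G ≤ κ) :
    #(generated G) ≤ κ := by
  have hn (n : ℕ) : #(step^[n] (G ∪ {∅, Set.univ, SetRel.id}) : Set (SetRel U U)) ≤ κ := by
    induction n with
    | zero =>
      refine (mk_union_le _ _).trans (add_le_of_le hκ hG (le_trans ?_ hκ))
      exact (Set.Finite.lt_aleph0 (by simp)).le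
    | succ n ih => rw [Function.iterate_succ_apply']; exact mk_step_le hκ ih
  have h := mk_iUnion_le_lift
    (fun n : ℕ => step^[n] (G ∪ {∅, Set.univ, SetRel.id} : Set (SetRel U U)))
  refine le_trans ?_ ((mul_le_mul' (by simpa using hκ) (ciSup_le' hn)).trans (mul_eq_self hκ).le)
  simpa [generated, closure] using h

end Generated

/-! ### Algebras with unit U × U: simplicity, and forks from pairings -/

section Unit

variable {P : ProperRelationAlgebra U}

/-- A proper relation algebra whose unit is `U × U` is simple. -/
theorem simple_of_unit_eq_univ (hP : P.unit = Set.univ) : Simple P := by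
  intro θ hθ
  have refl := hθ.equivalence.refl
  by_cases h : ∀ x y, θ x y → x = y
  · exact .inl fun x y => ⟨h x y, fun e => e ▸ refl x⟩
  push Not at h
  obtain ⟨x, y, hxy, hne⟩ := h
  right
  -- A nonzero element congruent to 0 collapses the algebra: 1;d;1 = 1 because the unit is U × U,
  -- whereas 1;0;1 = 0.
  have key : ∀ d : P, θ d ⊥ → d ≠ ⊥ → ∀ z w, θ z w := by
    intro d hd hd0
    obtain ⟨⟨a, b⟩, hab⟩ : d.1.Nonempty := by
      rw [Set.nonempty_iff_ne_empty]; exact fun h => hd0 (Subtype.ext h)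
    have h1 : comp (comp ⊤ d) ⊤ = (⊤ : P) := by
      refine le_antisymm le_top ?_
      rintro ⟨c, e⟩ -
      have hu : ∀ p, p ∈ (⊤ : P).1 := fun p => (hP ▸ Set.mem_univ p : p ∈ P.unit)
      exact ⟨b, ⟨a, hu _, hab⟩, hu _⟩
    have h2 : comp (comp ⊤ ⊥) ⊤ = (⊥ : P) := by
      refine le_antisymm ?_ bot_le
      rintro ⟨c, e⟩ ⟨_, ⟨_, _, h⟩, _⟩
      exact h
    have h3 : θ ⊤ ⊥ := by
      have := hθ.comp (hθ.comp (refl ⊤) hd) (refl ⊤)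
      rwa [h1, h2] at this
    have h4 : ∀ z, θ z ⊥ := fun z => by simpa using hθ.inf (refl z) h3
    exact fun z w => hθ.equivalence.trans (h4 z) (hθ.equivalence.symm (h4 w))
  by_cases h : x ≤ y
  · refine key (y ⊓ xᶜ) ?_ fun h' => hne (le_antisymm h ?_)
    · simpa using hθ.equivalence.symm (hθ.inf hxy (refl xᶜ))
    · rwa [← sdiff_eq, sdiff_eq_bot_iff] at h'
  · refine key (x ⊓ yᶜ) ?_ fun h' => h ?_
    · simpa using hθ.inf hxy (refl yᶜ)
    · rwa [← sdiff_eq, sdiff_eq_bot_iff] at h'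

/-- The relation `1' ∇ 1` of the fork given by the pairing `e`. -/
def leftProj (e : U × U → U) : SetRel U U := {x | ∃ z, x.2 = e (x.1, z)}

/-- The relation `1 ∇ 1'` of the fork given by the pairing `e`. -/
def rightProj (e : U × U → U) : SetRel U U := {x | ∃ z, x.2 = e (z, x.1)}

/-- The two factors decode c as two pairs; injectivity of `e` makes these pairs equal. -/
theorem mem_fork {e : U × U → U} (he : Function.Injective e) {r s : SetRel U U} {a c : U} :
    (a, c) ∈ (r ○ leftProj e) ∩ (s ○ rightProj e) ↔
      ∃ y z, (a, y) ∈ r ∧ (a, z) ∈ s ∧ c = e (y, z) := by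
  constructor
  · rintro ⟨⟨y, hy, z', h⟩, ⟨z, hz, y', h'⟩⟩
    obtain ⟨rfl, rfl⟩ := Prod.ext_iff.1 (he (h.symm.trans h'))
    exact ⟨_, _, hy, hz, h⟩
  · rintro ⟨y, z, hy, hz, h⟩
    exact ⟨⟨y, hy, z, h⟩, ⟨z, hz, y, h⟩⟩

/-- The fork operation given by an injective pairing function. -/
def forkOfPairing (hP : P.unit = Set.univ) (e : U × U → U) (he : Function.Injective e)
    (hl : leftProj e ∈ P.carrier) (hr : rightProj e ∈ P.carrier) : ForkExpansion P :=
  have hu : ∀ p, p ∈ (⊤ : P).1 := fun p => (hP ▸ Set.mem_univ p : p ∈ P.unit)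
  -- The fork defined below returns the projections it was built from, which is what `fork_eq`
  -- requires.
  have hl' : (comp ide ⟨_, hl⟩ ⊓ comp ⊤ ⟨_, hr⟩ : P) = ⟨_, hl⟩ := by
    refine Subtype.ext (Set.ext fun ⟨a, c⟩ => (mem_fork he).trans ⟨?_, ?_⟩)
    · rintro ⟨y, z, h, -, rfl⟩
      obtain rfl : a = y := h
      exact ⟨z, rfl⟩
    · rintro ⟨z, h⟩
      exact ⟨a, z, rfl, hu _, h⟩
  have hr' : (comp ⊤ ⟨_, hl⟩ ⊓ comp ide ⟨_, hr⟩ : P) = ⟨_, hr⟩ := by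
    refine Subtype.ext (Set.ext fun ⟨a, c⟩ => (mem_fork he).trans ⟨?_, ?_⟩)
    · rintro ⟨y, z, -, h, rfl⟩
      obtain rfl : a = z := h
      exact ⟨y, rfl⟩
    · rintro ⟨z, h⟩
      exact ⟨z, a, hu _, rfl, h⟩
  { fork := fun r s => comp r ⟨_, hl⟩ ⊓ comp s ⟨_, hr⟩
    fork_eq := fun r s => by rw [hl', hr']
    fork_comp_conv := fun r s t w => by
      refine Subtype.ext (Set.ext fun ⟨a, c⟩ => ?_)
      constructor
      · rintro ⟨b, h₁, h₂⟩
        obtain ⟨y, z, hy, hz, rfl⟩ := (mem_fork he).1 h₁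
        obtain ⟨y', z', hy', hz', h⟩ := (mem_fork he).1 h₂
        obtain ⟨rfl, rfl⟩ := Prod.ext_iff.1 (he h)
        exact ⟨⟨_, hy, hy'⟩, ⟨_, hz, hz'⟩⟩
      · rintro ⟨⟨y, hy, hy'⟩, ⟨z, hz, hz'⟩⟩
        exact ⟨e (y, z), (mem_fork he).2 ⟨y, z, hy, hz, rfl⟩, (mem_fork he).2 ⟨y, z, hy', hz', rfl⟩⟩
    fork_proj_le := by
      rw [hl', hr']
      rintro ⟨a, c⟩ h
      -- Here a codes a pair with components y and z, and pairing these again returns a.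
      obtain ⟨y, z, ⟨z', h₁⟩, ⟨y', h₂⟩, rfl⟩ := (mem_fork he).1 h
      have h := h₁.symm.trans h₂
      obtain ⟨rfl, rfl⟩ := Prod.ext_iff.1 (he h)
      exact h₁ }

/-- A proper relation algebra with unit `U × U` has at least as many forks as pairing functions
whose projections it contains. -/
theorem mk_le_forkIndex (hP : P.unit = Set.univ) {ι : Type u} (e : ι → U × U → U)
    (he : ∀ i, Function.Injective (e i)) (hinj : Function.Injective e)
    (hl : ∀ i, leftProj (e i) ∈ P.carrier) (hr : ∀ i, rightProj (e i) ∈ P.carrier) :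
    #ι ≤ forkIndex P := by
  refine mk_le_of_injective (f := fun i => forkOfPairing hP (e i) (he i) (hl i) (hr i)) ?_
  intro i j hij
  have hu : ∀ p, p ∈ (⊤ : P).1 := fun p => (hP ▸ Set.mem_univ p : p ∈ P.unit)
  have h₁ := congr_arg (fun F : ForkExpansion P => (F.fork ide ⊤).1) hij
  have h₂ := congr_arg (fun F : ForkExpansion P => (F.fork ⊤ ide).1) hij
  refine hinj (funext fun ⟨y, z⟩ => ?_)
  -- Decoded by `e j`, the value `e i (y, z)` has first component y by `k₁` and second component z
  -- by `k₂`.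
  have k₁ : (y, e i (y, z)) ∈ ((ide : P).1 ○ leftProj (e j)) ∩ ((⊤ : P).1 ○ rightProj (e j)) :=
    h₁.subset ((mem_fork (he i)).2 ⟨y, z, rfl, hu _, rfl⟩)
  have k₂ : (z, e i (y, z)) ∈ ((⊤ : P).1 ○ leftProj (e j)) ∩ ((ide : P).1 ○ rightProj (e j)) :=
    h₂.subset ((mem_fork (he i)).2 ⟨y, z, hu _, rfl, rfl⟩)
  obtain ⟨y₁, z₁, hy₁, -, q₁⟩ := (mem_fork (he j)).1 k₁
  obtain ⟨y₂, z₂, -, hz₂, q₂⟩ := (mem_fork (he j)).1 k₂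
  obtain rfl : y = y₁ := hy₁
  obtain rfl : z = z₂ := hz₂
  obtain ⟨rfl, rfl⟩ := Prod.ext_iff.1 (he j (q₁.symm.trans q₂))
  exact q₁

end Unit

end ProperRelationAlgebra

namespace ProperRelationAlgebra

open RelationAlgebra

variable {U : Type u}

/-! ### Rigidity: isomorphisms fixing a well order -/

section Rigidity

variable {P Q : ProperRelationAlgebra U} (hP : ∀ a, {(a, a)} ∈ P.carrier)
  (hQ : ∀ a, {(a, a)} ∈ Q.carrier)

/-- The relation `{(a, a)}` as an element of an algebra containing it. -/
def point (hP : ∀ a, {(a, a)} ∈ P.carrier) (a : U) : P := ⟨{(a, a)}, hP a⟩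

theorem ne_bot_iff {x : P} : x ≠ ⊥ ↔ ∃ p, p ∈ x.1 := by
  rw [← Set.nonempty_def, Set.nonempty_iff_ne_empty, not_iff_not, Subtype.ext_iff]
  rfl

/-- Expresses membership of a pair through points and operations alone, so that isomorphisms
transport it. -/
theorem point_comp_point_ne_bot_iff {x : P} {a b : U} :
    comp (comp (point hP a) x) (point hP b) ≠ ⊥ ↔ (a, b) ∈ x.1 := by
  rw [ne_bot_iff]
  constructor
  · rintro ⟨⟨c, d⟩, z, ⟨y, h₁, h₂⟩, h₃⟩
    have hy : y = a := congr_arg Prod.snd (Set.mem_singleton_iff.1 h₁)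
    have hz : z = b := congr_arg Prod.fst (Set.mem_singleton_iff.1 h₃)
    rwa [hy, hz] at h₂
  · exact fun h => ⟨(a, b), b, ⟨a, rfl, h⟩, rfl⟩

-- Points are exactly the atoms below the identity, and isomorphisms preserve this description.
include hP hQ in
theorem exists_apply_point (f : Iso P Q) (a : U) :
    ∃ b, f.toRelIso (point hP a) = point hQ b := by
  have hatom : IsAtom (point hP a) := by
    refine ⟨ne_bot_iff.2 ⟨(a, a), rfl⟩, fun x hx => by_contra fun h => ?_⟩
    obtain ⟨p, hp⟩ := ne_bot_iff.1 h
    obtain rfl : p = (a, a) := hx.le hp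
    exact hx.not_ge (Set.singleton_subset_iff.2 hp)
  have hatom' : IsAtom (f.toRelIso (point hP a)) := (OrderIso.isAtom_iff f.toRelIso _).2 hatom
  have hid : f.toRelIso (point hP a) ≤ ide := by
    rw [← f.apply_ide]
    refine (OrderIso.le_iff_le f.toRelIso).2 (Set.singleton_subset_iff.2 rfl)
  obtain ⟨⟨c, d⟩, hcd⟩ := ne_bot_iff.1 hatom'.1
  obtain rfl : c = d := hid hcd
  refine ⟨c, ((hatom'.le_iff.1 (Set.singleton_subset_iff.2 hcd : point hQ c ≤ _)).resolve_left
    (ne_bot_iff.2 ⟨(c, c), Set.mem_singleton _⟩)).symm⟩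

include hP hQ in
/-- If two algebras contain all points and a common well order, an isomorphism fixing that well
order is the identity. -/
theorem iso_eq_of_fixes_wellOrder {lt : U → U → Prop} [IsWellOrder U lt] (f : Iso P Q)
    (w : P) (hw : w.1 = {p | lt p.1 p.2}) (hf : (f.toRelIso w).1 = w.1) (x : P) :
    (f.toRelIso x).1 = x.1 := by
  choose π hπ using exists_apply_point hP hQ f
  choose ρ hρ using exists_apply_point hQ hP f.symm
  have hpt {R : ProperRelationAlgebra U} (hR : ∀ a, {(a, a)} ∈ R.carrier) :
      Function.Injective (point hR) := fun a b h => by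
    simpa [point] using congr_arg Subtype.val h
  have h₁ (a : U) : π (ρ a) = a := hpt hQ <| by
    rw [← hπ, ← hρ]; exact f.toRelIso.apply_symm_apply _
  have h₂ (a : U) : ρ (π a) = a := hpt hP <| by
    rw [← hρ, ← hπ]; exact f.toRelIso.symm_apply_apply _
  have hmem (x : P) (a b : U) : (π a, π b) ∈ (f.toRelIso x).1 ↔ (a, b) ∈ x.1 := by
    rw [← point_comp_point_ne_bot_iff hQ, ← hπ, ← hπ, ← f.apply_comp, ← f.apply_comp,
      ← f.apply_bot, f.toRelIso.injective.ne_iff, point_comp_point_ne_bot_iff]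
  let σ : lt ≃r lt := ⟨⟨π, ρ, h₂, h₁⟩, fun {a b} => by
    have := hmem w a b
    rwa [hf, hw] at this⟩
  -- A well order has no automorphism but the identity.
  have hσ (a : U) : π a = a := InitialSeg.eq σ.toInitialSeg (RelIso.refl lt).toInitialSeg a
  refine Set.ext fun ⟨a, b⟩ => ?_
  rw [← hmem x, hσ, hσ]

end Rigidity

/-! ### Explosive algebras indexed by subsets of U -/

section Construction

/-- The diagonal relation on a set. -/
def diag (S : Set U) : SetRel U U := {p | p.1 = p.2 ∧ p.1 ∈ S}

/-- A family of relations depending on a set `S`: all points, a well order, the diagonal of `S` and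
the projections of a family of pairing functions. -/
def generators (e : U → U × U → U) (S : Set U) : Set (SetRel U U) :=
  Set.range (fun a => {(a, a)}) ∪ ({{p | WellOrderingRel p.1 p.2}, diag S} ∪
    (Set.range (fun a => leftProj (e a)) ∪ Set.range fun a => rightProj (e a)))

/-- The proper relation algebra generated by `generators e S`. -/
abbrev rigidAlgebra (e : U → U × U → U) (S : Set U) : ProperRelationAlgebra U :=
  generated (generators e S)

variable {e : U → U × U → U} {S T : Set U}

theorem point_mem (a : U) : {(a, a)} ∈ (rigidAlgebra e S).carrier :=
  mem_generated (.inl ⟨a, rfl⟩)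

theorem wellOrder_mem : {p | WellOrderingRel p.1 p.2} ∈ (rigidAlgebra e S).carrier :=
  mem_generated (.inr (.inl (.inl rfl)))

theorem diag_mem : diag S ∈ (rigidAlgebra e S).carrier :=
  mem_generated (.inr (.inl (.inr rfl)))

theorem leftProj_mem (a : U) : leftProj (e a) ∈ (rigidAlgebra e S).carrier :=
  mem_generated (.inr (.inr (.inl ⟨a, rfl⟩)))

theorem rightProj_mem (a : U) : rightProj (e a) ∈ (rigidAlgebra e S).carrier :=
  mem_generated (.inr (.inr (.inr ⟨a, rfl⟩)))

theorem mk_rigidAlgebra (hU : ℵ₀ ≤ #U) : #(rigidAlgebra e S) = #U := by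
  refine le_antisymm (mk_generated_le hU ?_)
    (mk_le_of_injective (f := point point_mem) fun a b h => ?_)
  · have hun {X Y : Set (SetRel U U)} (hX : #X ≤ #U) (hY : #Y ≤ #U) : #(X ∪ Y : Set _) ≤ #U :=
      (mk_union_le X Y).trans (add_le_of_le hU hX hY)
    refine hun mk_range_le (hun ?_ (hun mk_range_le mk_range_le))
    exact (Set.Finite.lt_aleph0 (by simp)).le.trans hU
  · simpa [point] using congr_arg Subtype.val h

theorem explosive_rigidAlgebra (hU : ℵ₀ ≤ #U) (he : ∀ a, Function.Injective (e a))
    (hinj : Function.Injective e) : Explosive (rigidAlgebra e S) := by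
  have h := mk_rigidAlgebra (e := e) (S := S) hU
  refine explosive_of_le (h ▸ hU) ?_
  rw [h]
  exact mk_le_forkIndex rfl e he hinj leftProj_mem rightProj_mem

theorem prime_rigidAlgebra (hU : ℵ₀ ≤ #U) : Prime (rigidAlgebra e S) :=
  ⟨simple_of_unit_eq_univ rfl, not_trivial_of_aleph0_le ((mk_rigidAlgebra hU).symm ▸ hU)⟩

/-- An infinite set carries as many pairing functions as it has elements. -/
theorem exists_pairings (hU : ℵ₀ ≤ #U) : ∃ e : U → U × U → U,
    (∀ a, Function.Injective (e a)) ∧ Function.Injective e := by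
  classical
  obtain ⟨p⟩ : Nonempty (U × U ≃ U) := by rw [← Cardinal.eq, ← mul_def, mul_eq_self hU]
  have := infinite_iff.2 hU
  obtain ⟨o⟩ : Nonempty U := inferInstance
  -- The parameter a is recovered as the value at `p.symm o`.
  refine ⟨fun a => Equiv.swap o a ∘ p, fun a => (Equiv.swap o a).injective.comp p.injective,
    fun a b h => ?_⟩
  simpa using congr_fun h (p.symm o)

/-- The images of the well order and of `diag T` under a chosen isomorphism determine T. If they
agree for T and T', composing one isomorphism with the inverse of the other fixes the well order,
hence every relation, yet sends `diag T` to `diag T'`. -/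
theorem mk_isomorphic_le (hU : ℵ₀ ≤ #U) (S : Set U) :
    #{T : Set U | Isomorphic (rigidAlgebra e T) (rigidAlgebra e S)} ≤ #U := by
  let f (T : {T : Set U | Isomorphic (rigidAlgebra e T) (rigidAlgebra e S)}) := Classical.choice T.2
  have key : Function.Injective fun T =>
      ((f T).toRelIso ⟨_, wellOrder_mem⟩, (f T).toRelIso ⟨_, diag_mem⟩) := by
    intro T T' h
    obtain ⟨h₁, h₂⟩ := Prod.ext_iff.1 h
    let g := (f T).trans (f T').symm
    have g₁ : g.toRelIso ⟨_, wellOrder_mem⟩ = ⟨_, wellOrder_mem⟩ :=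
      (congr_arg (f T').toRelIso.symm h₁).trans ((f T').toRelIso.symm_apply_apply _)
    have g₂ : g.toRelIso ⟨_, diag_mem⟩ = ⟨_, diag_mem⟩ :=
      (congr_arg (f T').toRelIso.symm h₂).trans ((f T').toRelIso.symm_apply_apply _)
    have h := iso_eq_of_fixes_wellOrder (lt := WellOrderingRel) point_mem point_mem g ⟨_, wellOrder_mem⟩ rfl
      (congr_arg Subtype.val g₁) ⟨_, diag_mem⟩
    rw [g₂] at h
    refine Subtype.ext (Set.ext fun a => ?_)
    have := Set.ext_iff.1 h (a, a)
    simpa [diag] using this.symm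
  refine (mk_le_of_injective key).trans ?_
  rw [← mul_def, mk_rigidAlgebra hU, mul_eq_self hU]

/-- Among the algebras `rigidAlgebra e S` there are at least `#U` isomorphism types. -/
theorem exists_nonisomorphic_family (hU : ℵ₀ ≤ #U) (e : U → U × U → U) :
    ∃ S : U → Set U, ∀ i j, i ≠ j → ¬ Isomorphic (rigidAlgebra e (S i)) (rigidAlgebra e (S j)) := by
  let s : Setoid (Set U) :=
    { r := fun S T => Isomorphic (rigidAlgebra e S) (rigidAlgebra e T)
      iseqv := ⟨fun _ => ⟨Iso.refl _⟩, fun ⟨f⟩ => ⟨f.symm⟩, fun ⟨f⟩ ⟨g⟩ => ⟨f.trans g⟩⟩ }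
  let C (q : Quotient s) : Set (Set U) :=
    {T | Isomorphic (rigidAlgebra e T) (rigidAlgebra e q.out)}
  have hC (q : Quotient s) : #(C q) ≤ #U := mk_isomorphic_le hU q.out
  have hcover (T : Set U) : T ∈ C ⟦T⟧ := Quotient.exact (s := s) (Quotient.out_eq ⟦T⟧).symm
  have hQ : #U ≤ #(Quotient s) := by
    -- Otherwise fewer than #U classes, each of size at most #U, would cover all 2^#U subsets.
    by_contra! h
    refine (cantor #U).not_ge ?_
    rw [← mk_set, ← mk_univ, ← Set.eq_univ_of_forall fun T => Set.mem_iUnion.2 ⟨_, hcover T⟩]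
    exact (mk_iUnion_le C).trans <| (mul_le_mul' h.le (ciSup_le' hC)).trans (mul_eq_self hU).le
  obtain ⟨φ⟩ := hQ
  refine ⟨fun i => (φ i).out, fun i j hij h => hij (φ.injective ?_)⟩
  rw [← Quotient.out_eq (φ i), ← Quotient.out_eq (φ j)]
  exact Quotient.sound h

end Construction

end ProperRelationAlgebra

namespace RelationAlgebra

/-! ### Ideal elements of simple algebras -/

section Product

/-- The ideal elements of a simple relation algebra are `0` and `1`. -/
theorem Simple.eq_bot_or_eq_top {U : Type u} {R : ProperRelationAlgebra U} (hR : Simple R) {i : R}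
    (hi : i ∈ idealElements R) : i = ⊥ ∨ i = ⊤ := by
  have hi : i = comp (comp ⊤ i) ⊤ := hi
  -- Composition is well defined modulo i, since i = 1;i;1 absorbs products with any element on
  -- either side.
  have hsup (a b : R) : comp (a ⊔ i) (b ⊔ i) ⊔ i = comp a b ⊔ i := by
    refine Subtype.ext (Set.ext fun ⟨x, z⟩ => ⟨?_, ?_⟩)
    · have hid : ∀ y, (y, y) ∈ (⊤ : R).1 := fun y => (le_top : (ide : R) ≤ ⊤) (rfl : y = y)
      rintro (⟨y, h₁ | h₁, h₂ | h₂⟩ | h)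
      · exact .inl ⟨y, h₁, h₂⟩
      · right; rw [hi]; exact ⟨z, ⟨y, (le_top : a ≤ ⊤) h₁, h₂⟩, hid z⟩
      · right; rw [hi]; exact ⟨y, ⟨x, hid x, h₁⟩, (le_top : b ≤ ⊤) h₂⟩
      · right; rw [hi]; exact ⟨z, ⟨y, (le_top : i ≤ ⊤) h₁, h₂⟩, hid z⟩
      · exact .inr h
    · rintro (⟨y, h₁, h₂⟩ | h)
      · exact .inl ⟨y, .inl h₁, .inl h₂⟩
      · exact .inr h
  -- A pair (z, x) in i, composed on both sides with (x, z) in 1, puts (x, z) into 1;i;1 = i.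
  have hconv : conv i = i := by
    have h : conv i ≤ i := by
      rintro ⟨x, z⟩ h
      have h' : (x, z) ∈ (⊤ : R).1 :=
        (le_top : conv i ≤ ⊤) h
      rw [hi]
      exact ⟨x, ⟨z, h', h⟩, h'⟩
    refine le_antisymm h fun ⟨x, z⟩ hxz => h (show (x, z) ∈ (conv (conv i)).1 from hxz)
  -- This congruence identifies i with 0: it is equality only if i = 0, and total only if i = 1.
  have hc : IsCongruence R fun a b => a ⊔ i = b ⊔ i :=
    { equivalence := ⟨fun _ => rfl, Eq.symm, Eq.trans⟩
      sup := fun {x x' y y'} h₁ h₂ => by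
        rw [sup_sup_distrib_right, h₁, h₂, ← sup_sup_distrib_right]
      inf := fun {x x' y y'} h₁ h₂ => by rw [sup_inf_right, h₁, h₂, ← sup_inf_right]
      compl := fun {x x'} h => by
        have key (a : R) : (a ⊔ i)ᶜ ⊔ i = aᶜ ⊔ i := by rw [compl_sup, sup_inf_right]; simp
        rw [← key, h, key]
      comp := fun {x x' y y'} h₁ h₂ => by rw [← hsup, h₁, h₂, hsup]
      conv := fun {x x'} h => by rw [← hconv, ← conv_sup, h, conv_sup] }
  rcases hR _ hc with h | h
  · left; exact (h i ⊥).1 (by simp)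
  · right; simpa using h ⊥ ⊤

end Product

end RelationAlgebra

namespace RelationAlgebra

/-! ### Products with powers of the two-element algebra -/

section Product

variable {U : Type u} {R : ProperRelationAlgebra U} {Z Z' : Type u}

/-- Relative product in 2^Z is the meet, so 1;x;1 = x there and only the component in R is
constrained. -/
theorem mem_idealElements_prod_iff (hR : Simple R) {x : (Z → Bool) × R} :
    x ∈ idealElements ((Z → Bool) × R) ↔ x.2 = ⊥ ∨ x.2 = ⊤ := by
  constructor
  · exact fun h => hR.eq_bot_or_eq_top (congr_arg Prod.snd h)
  · intro h
    refine Prod.ext (funext fun z => ?_) ?_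
    · change x.1 z = (⊤ ⊓ x.1 z) ⊓ ⊤
      rw [top_inf_eq, inf_top_eq]
    · change x.2 = comp (comp ⊤ x.2) ⊤
      rcases h with h | h <;> rw [h] <;> refine Subtype.ext (Set.ext fun ⟨a, b⟩ => ?_)
      · refine ⟨False.elim, ?_⟩
        rintro ⟨_, ⟨_, _, h⟩, _⟩
        exact h
      · constructor
        · intro h
          have hid : ∀ y, (y, y) ∈ (⊤ : R).1 := fun y => (le_top : (ide : R) ≤ ⊤) (rfl : y = y)
          exact ⟨a, ⟨a, hid a, hid a⟩, h⟩
        · exact fun h => (le_top : comp (comp ⊤ ⊤) ⊤ ≤ (⊤ : R)) h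

/-- The ideal elements of `2 ^ Z × R`, for `R` simple and nondegenerate, form the Boolean algebra
of sets on a set with one more element than `Z`. -/
noncomputable def idealElementsOrderIso (hR : Simple R) (hne : (⊥ : R) ≠ ⊤) :
    idealElements ((Z → Bool) × R) ≃o Set (Option Z) where
  toFun x := {o | o.elim (x.1.2 = ⊤) fun z => x.1.1 z = true}
  invFun s := open Classical in
    ⟨(fun z => decide (some z ∈ s), if none ∈ s then ⊤ else ⊥),
      (mem_idealElements_prod_iff hR).2 <| by by_cases h : none ∈ s <;> simp [h]⟩
  left_inv x := by
    refine Subtype.ext (Prod.ext (funext fun z => ?_) ?_)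
    · exact Bool.decide_eq_true
    · rcases (mem_idealElements_prod_iff hR).1 x.2 with h | h <;> simp [h, hne]
  right_inv s := by
    ext o
    cases o with
    | none => by_cases h : none ∈ s <;> simp [h, hne]
    | some z => simp
  map_rel_iff' := by
    rintro ⟨x, hx⟩ ⟨y, hy⟩
    constructor
    · refine fun h => ⟨fun z => Bool.le_iff_imp.2 (@h (some z)), ?_⟩
      rcases (mem_idealElements_prod_iff hR).1 hx with h' | h'
      · exact h'.le.trans bot_le
      · exact le_top.trans (@h none h').ge
    · rintro ⟨h₁, h₂⟩ (_ | z) h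
      · exact top_le_iff.1 ((show x.2 = ⊤ from h).ge.trans h₂)
      · exact Bool.le_iff_imp.1 (h₁ z) h

theorem mk_idealElements_prod (hR : Simple R) (hne : (⊥ : R) ≠ ⊤) :
    #(idealElements ((Z → Bool) × R)) = 2 ^ (#Z + 1) := by
  rw [mk_congr (idealElementsOrderIso hR hne).toEquiv, mk_set, mk_option]

theorem Iso.mem_idealElements_iff {A B : Type*} [RelationAlgebra A] [RelationAlgebra B]
    (f : Iso A B) {x : A} : f.toRelIso x ∈ idealElements B ↔ x ∈ idealElements A := by
  change f.toRelIso x = _ ↔ x = _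
  rw [← f.apply_top, ← f.apply_comp, ← f.apply_comp, f.toRelIso.injective.eq_iff]

/-- An isomorphism restricts to the ideal elements. -/
def Iso.idealElements {A B : Type*} [RelationAlgebra A] [RelationAlgebra B] (f : Iso A B) :
    idealElements A ≃o idealElements B where
  toEquiv := f.toEquiv.subtypeEquiv fun _ => f.mem_idealElements_iff.symm
  map_rel_iff' := f.toRelIso.map_rel_iff

theorem mk_le_of_setOrderIso {X Y : Type u} (f : Set X ≃o Set Y) : #X ≤ #Y := by
  have h (x : X) : ∃ y, f {x} = {y} :=
    Set.isAtom_iff.1 ((f.isAtom_iff _).2 (Set.isAtom_singleton x))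
  choose g hg using h
  refine mk_le_of_injective (f := g) fun a b h => ?_
  exact Set.singleton_injective (f.injective ((hg a).trans (h ▸ (hg b).symm)))

/-- Counting ideal elements would not suffice, since equal powers of 2 need not have equal
exponents; their order also yields the number of atoms. -/
theorem mk_eq_of_isomorphic_prod (hR : Simple R) (hne : (⊥ : R) ≠ ⊤)
    (h : Isomorphic ((Z → Bool) × R) ((Z' → Bool) × R)) : #Z = #Z' := by
  obtain ⟨f⟩ := h
  let g : Set (Option Z) ≃o Set (Option Z') :=
    (idealElementsOrderIso hR hne).symm.trans
      (f.idealElements.trans (idealElementsOrderIso hR hne))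
  have h := (mk_le_of_setOrderIso g).antisymm (mk_le_of_setOrderIso g.symm)
  rwa [mk_option, mk_option, add_one_inj] at h

/-- The Boolean component of a fork on `2 ^ Z × A` is the meet. -/
theorem ForkExpansion.fork_prod_fst {A : Type u} [RelationAlgebra A]
    (F : ForkExpansion ((Z → Bool) × A)) (x y : (Z → Bool) × A) :
    (F.fork x y).1 = x.1 ⊓ y.1 := by
  have hcomp (x y : (Z → Bool) × A) : (comp x y).1 = x.1 ⊓ y.1 := rfl
  have hconv (x : (Z → Bool) × A) : (conv x).1 = x.1 := rfl
  -- On the Boolean component, `h₂` forces 1 ∇ 1 = 1; by `h₁` both projections are then 1, and `h₃`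
  -- reduces to the meet.
  have h₁ := congr_arg Prod.fst (F.fork_eq ⊤ ⊤)
  have h₂ := congr_arg Prod.fst (F.fork_comp_conv ⊤ ⊤ ⊤ ⊤)
  have h₃ := congr_arg Prod.fst (F.fork_eq x y)
  rw [hcomp, hconv, inf_idem, Prod.fst_inf, hcomp, hconv, inf_idem, Prod.fst_top, inf_top_eq] at h₂
  rw [h₂, Prod.fst_inf, hcomp, hcomp, Prod.fst_top, top_inf_eq, top_inf_eq] at h₁
  obtain ⟨hp, hq⟩ := inf_eq_top_iff.1 h₁.symm
  rw [h₃, Prod.fst_inf, hcomp, hcomp, hp, hq, inf_top_eq, inf_top_eq]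

/-- Restricting a fork to first coordinate ⊤, which is both unit and identity of 2^Z, loses nothing
because the Boolean component is forced. Conversely, any fork on A extends by the meet. -/
theorem forkIndex_prod (Z : Type u) (A : Type u) [RelationAlgebra A] :
    forkIndex ((Z → Bool) × A) = forkIndex A := by
  refine le_antisymm (mk_le_of_injective (f := fun F =>
    { fork := fun r s => (F.fork (⊤, r) (⊤, s)).2
      fork_eq := fun r s => congr_arg Prod.snd (F.fork_eq (⊤, r) (⊤, s))
      fork_comp_conv := fun r s t w =>
        congr_arg Prod.snd (F.fork_comp_conv (⊤, r) (⊤, s) (⊤, t) (⊤, w))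
      fork_proj_le := ?_ }) ?_) (mk_le_of_injective (f := fun F =>
    { fork := fun x y => (x.1 ⊓ y.1, F.fork x.2 y.2)
      fork_eq := fun x y => Prod.ext ?_ (F.fork_eq x.2 y.2)
      fork_comp_conv := fun x y z w => Prod.ext ?_ (F.fork_comp_conv x.2 y.2 z.2 w.2)
      fork_proj_le := ⟨le_top, F.fork_proj_le⟩ }) ?_)
  · change _ ≤ (ide : (Z → Bool) × A).2
    convert F.fork_proj_le.2 using 2
    congr 1 <;> refine Prod.ext ?_ rfl
    · change ⊤ = (F.fork ide ⊤).1
      rw [F.fork_prod_fst]; exact (inf_idem ⊤).symm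
    · change ⊤ = (F.fork ⊤ ide).1
      rw [F.fork_prod_fst]; exact (inf_idem ⊤).symm
  · intro F G h
    have h' (r s : A) : (F.fork (⊤, r) (⊤, s)).2 = (G.fork (⊤, r) (⊤, s)).2 :=
      congr_arg (fun H : ForkExpansion A => H.fork r s) h
    refine ForkExpansion.projections_injective (Prod.ext (Prod.ext ?_ ?_) (Prod.ext ?_ ?_))
    · exact (F.fork_prod_fst _ _).trans (G.fork_prod_fst _ _).symm
    · exact h' ide ⊤
    · exact (F.fork_prod_fst _ _).trans (G.fork_prod_fst _ _).symm
    · exact h' ⊤ ide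
  · change x.1 ⊓ y.1 = (x.1 ⊓ (⊤ ⊓ ⊤)) ⊓ (y.1 ⊓ (⊤ ⊓ ⊤))
    simp
  · change (x.1 ⊓ y.1) ⊓ (z.1 ⊓ w.1) = (x.1 ⊓ z.1) ⊓ (y.1 ⊓ w.1)
    exact inf_inf_inf_comm _ _ _ _
  · intro F G h
    ext r s
    exact congr_arg (fun H : ForkExpansion ((Z → Bool) × A) => (H.fork (⊤, r) (⊤, s)).2) h

/-! ### Representing the product on a disjoint union -/

section Representation

/-- The relation on `Z ⊕ U` that is the diagonal of `x.1` on `Z` and `x.2` on `U`. -/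
def sumRel (x : (Z → Bool) × SetRel U U) : SetRel (Z ⊕ U) (Z ⊕ U) :=
  {p | (∃ z, x.1 z = true ∧ p = (.inl z, .inl z)) ∨ ∃ a b, (a, b) ∈ x.2 ∧ p = (.inr a, .inr b)}

theorem inl_inl_mem_sumRel {x : (Z → Bool) × SetRel U U} {y z : Z} :
    (Sum.inl y, Sum.inl z) ∈ sumRel x ↔ y = z ∧ x.1 y = true := by
  simp only [sumRel, Set.mem_ofPred_eq, Prod.mk.injEq, Sum.inl.injEq, reduceCtorEq, and_false,
    exists_false, or_false]
  exact ⟨fun ⟨w, h, h₁, h₂⟩ => by subst h₁ h₂; exact ⟨rfl, h⟩, fun ⟨h, h'⟩ => ⟨y, h', rfl, h.symm⟩⟩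

theorem inr_inr_mem_sumRel {x : (Z → Bool) × SetRel U U} {a b : U} :
    (Sum.inr a, Sum.inr b) ∈ sumRel x ↔ (a, b) ∈ x.2 := by
  simp [sumRel]

theorem inl_inr_notMem_sumRel {x : (Z → Bool) × SetRel U U} {z : Z} {a : U} :
    (Sum.inl z, Sum.inr a) ∉ sumRel x := by
  simp [sumRel]

theorem inr_inl_notMem_sumRel {x : (Z → Bool) × SetRel U U} {z : Z} {a : U} :
    (Sum.inr a, Sum.inl z) ∉ sumRel x := by
  simp [sumRel]

theorem sumRel_subset_iff {x y : (Z → Bool) × SetRel U U} :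
    sumRel x ⊆ sumRel y ↔ x.1 ≤ y.1 ∧ x.2 ⊆ y.2 := by
  constructor
  · refine fun h => ⟨fun z => Bool.le_iff_imp.2 fun hz => ?_, fun p hp => ?_⟩
    · exact (inl_inl_mem_sumRel.1 (h (inl_inl_mem_sumRel.2 ⟨rfl, hz⟩))).2
    · exact inr_inr_mem_sumRel.1 (h (inr_inr_mem_sumRel.2 hp))
  · rintro ⟨h₁, h₂⟩ ⟨z | a, z' | b⟩ h
    · rw [inl_inl_mem_sumRel] at h ⊢
      exact ⟨h.1, Bool.le_iff_imp.1 (h₁ z) h.2⟩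
    · exact (inl_inr_notMem_sumRel h).elim
    · exact (inr_inl_notMem_sumRel h).elim
    · rw [inr_inr_mem_sumRel] at h ⊢
      exact h₂ h

theorem sumRel_union (x y : (Z → Bool) × SetRel U U) :
    sumRel (x.1 ⊔ y.1, x.2 ∪ y.2) = sumRel x ∪ sumRel y := by
  ext ⟨z | a, z' | b⟩ <;>
    simp [inl_inl_mem_sumRel, inr_inr_mem_sumRel, inl_inr_notMem_sumRel, inr_inl_notMem_sumRel]
  tauto

theorem sumRel_inter (x y : (Z → Bool) × SetRel U U) :
    sumRel (x.1 ⊓ y.1, x.2 ∩ y.2) = sumRel x ∩ sumRel y := by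
  ext ⟨z | a, z' | b⟩ <;>
    simp [inl_inl_mem_sumRel, inr_inr_mem_sumRel, inl_inr_notMem_sumRel, inr_inl_notMem_sumRel]
  tauto

theorem sumRel_diff (x : (Z → Bool) × SetRel U U) (E : SetRel U U) :
    sumRel (x.1ᶜ, E \ x.2) = sumRel (⊤, E) \ sumRel x := by
  ext ⟨z | a, z' | b⟩ <;>
    simp [inl_inl_mem_sumRel, inr_inr_mem_sumRel, inl_inr_notMem_sumRel, inr_inl_notMem_sumRel]
  tauto

theorem sumRel_comp (x y : (Z → Bool) × SetRel U U) :
    sumRel (x.1 ⊓ y.1, x.2 ○ y.2) = sumRel x ○ sumRel y := by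
  ext ⟨z | a, z' | b⟩ <;>
    simp [inl_inl_mem_sumRel, inr_inr_mem_sumRel, inl_inr_notMem_sumRel, inr_inl_notMem_sumRel]
  grind

theorem sumRel_inv (x : (Z → Bool) × SetRel U U) : sumRel (x.1, x.2.inv) = (sumRel x).inv := by
  ext ⟨z | a, z' | b⟩ <;>
    simp [inl_inl_mem_sumRel, inr_inr_mem_sumRel, inl_inr_notMem_sumRel, inr_inl_notMem_sumRel]
  constructor
  · rintro ⟨rfl, h⟩
    exact ⟨rfl, h⟩
  · rintro ⟨rfl, h⟩
    exact ⟨rfl, h⟩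

theorem sumRel_id : sumRel (⊤, SetRel.id) = (SetRel.id : SetRel (Z ⊕ U) (Z ⊕ U)) := by
  ext ⟨z | a, z' | b⟩ <;>
    simp [inl_inl_mem_sumRel, inr_inr_mem_sumRel, inl_inr_notMem_sumRel, inr_inl_notMem_sumRel]

theorem sumRel_empty : sumRel (⊥, ∅) = (∅ : SetRel (Z ⊕ U) (Z ⊕ U)) := by
  ext ⟨z | a, z' | b⟩ <;>
    simp [inl_inl_mem_sumRel, inr_inr_mem_sumRel, inl_inr_notMem_sumRel, inr_inl_notMem_sumRel]

/-- The proper relation algebra on `Z ⊕ U` representing `2 ^ Z × R`. -/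
def sumAlgebra (Z : Type u) (R : ProperRelationAlgebra U) : ProperRelationAlgebra (Z ⊕ U) where
  carrier := Set.range fun x : (Z → Bool) × R => sumRel (x.1, x.2.1)
  -- The unit is not a full square: each element of Z is related only to itself.
  unit := sumRel (⊤, R.unit)
  unit_mem := ⟨⊤, rfl⟩
  subset_unit := by
    rintro _ ⟨x, rfl⟩
    exact sumRel_subset_iff.2 ⟨le_top, R.subset_unit _ x.2.2⟩
  empty_mem := ⟨⊥, sumRel_empty⟩
  id_mem := ⟨ide, sumRel_id⟩
  union_mem := by
    rintro _ ⟨x, rfl⟩ _ ⟨y, rfl⟩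
    exact ⟨x ⊔ y, sumRel_union (x.1, x.2.1) (y.1, y.2.1)⟩
  inter_mem := by
    rintro _ ⟨x, rfl⟩ _ ⟨y, rfl⟩
    exact ⟨x ⊓ y, sumRel_inter (x.1, x.2.1) (y.1, y.2.1)⟩
  diff_mem := by
    rintro _ ⟨x, rfl⟩
    exact ⟨xᶜ, sumRel_diff (x.1, x.2.1) R.unit⟩
  comp_mem := by
    rintro _ ⟨x, rfl⟩ _ ⟨y, rfl⟩
    exact ⟨comp x y, sumRel_comp (x.1, x.2.1) (y.1, y.2.1)⟩
  inv_mem := by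
    rintro _ ⟨x, rfl⟩
    exact ⟨conv x, sumRel_inv (x.1, x.2.1)⟩

theorem representable_prod (Z : Type u) (R : ProperRelationAlgebra U) :
    Representable ((Z → Bool) × R) := by
  let f (x : (Z → Bool) × R) : sumAlgebra Z R := ⟨sumRel (x.1, x.2.1), x, rfl⟩
  have hf {x y} : f x ≤ f y ↔ x ≤ y := sumRel_subset_iff
  have hinj : Function.Injective f := fun x y h => (hf.1 h.le).antisymm (hf.1 h.ge)
  have hsurj : Function.Surjective f := by
    rintro ⟨_, x, rfl⟩
    exact ⟨x, rfl⟩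
  exact ⟨_, sumAlgebra Z R, ⟨{
    toRelIso := ⟨Equiv.ofBijective f ⟨hinj, hsurj⟩, hf⟩
    map_comp := fun x y => Subtype.ext (sumRel_comp (x.1, x.2.1) (y.1, y.2.1))
    map_conv := fun x => Subtype.ext (sumRel_inv (x.1, x.2.1))
    map_ide := Subtype.ext sumRel_id }⟩⟩

end Representation

end Product

end RelationAlgebra

open RelationAlgebra in
theorem mainTheorem6 (κ : Cardinal.{u}) (hκ : ℵ₀ ≤ κ) :
    -- there are `κ` pairwise non-isomorphic explosive proper relation algebras of cardinality `κ`
    (∃ (ι : Type u) (U : ι → Type u) (P : (i : ι) → ProperRelationAlgebra (U i)),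
      #ι = κ ∧ (∀ i, #(P i) = κ ∧ Explosive (P i)) ∧
      ∀ i j, i ≠ j → ¬ Isomorphic (P i) (P j)) ∧
    -- there is a prime explosive proper relation algebra of cardinality `κ`
    (∃ (U : Type u) (R : ProperRelationAlgebra U), Prime R ∧ Explosive R ∧ #R = κ) ∧
    -- the products of such an algebra with powers of the two-element relation algebra
    (∀ (U : Type u) (R : ProperRelationAlgebra U), Prime R → Explosive R → #R = κ →
      (∀ Z : Type u, #Z < κ →
        Representable ((Z → Bool) × R) ∧
        #(idealElements ((Z → Bool) × R)) = 2 ^ (#Z + 1) ∧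
        forkIndex ((Z → Bool) × R) = κ ∧
        (2 ^ #Z ≤ κ → #((Z → Bool) × R) = κ ∧ Explosive ((Z → Bool) × R))) ∧
      (∀ Z Z' : Type u, #Z < κ → #Z' < κ → #Z ≠ #Z' →
        ¬ Isomorphic ((Z → Bool) × R) ((Z' → Bool) × R))) := by
  have hsq : κ ^ 2 = κ := by rw [pow_two, mul_eq_self hκ]
  refine ⟨?_, ?_, fun U R hR hRe hRκ => ?_⟩
  · induction κ using Cardinal.inductionOn with
    | mk U =>
      obtain ⟨e, he, hinj⟩ := ProperRelationAlgebra.exists_pairings hκ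
      obtain ⟨S, hS⟩ := ProperRelationAlgebra.exists_nonisomorphic_family hκ e
      exact ⟨U, fun _ => U, fun i => ProperRelationAlgebra.rigidAlgebra e (S i), rfl, fun i =>
        ⟨ProperRelationAlgebra.mk_rigidAlgebra hκ,
          ProperRelationAlgebra.explosive_rigidAlgebra hκ he hinj⟩, hS⟩
  · induction κ using Cardinal.inductionOn with
    | mk U =>
      obtain ⟨e, he, hinj⟩ := ProperRelationAlgebra.exists_pairings hκ
      -- Any subset of U would serve in place of ∅.
      exact ⟨U, ProperRelationAlgebra.rigidAlgebra e ∅,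
        ProperRelationAlgebra.prime_rigidAlgebra hκ,
        ProperRelationAlgebra.explosive_rigidAlgebra hκ he hinj,
        ProperRelationAlgebra.mk_rigidAlgebra hκ⟩
  · have hne : (⊥ : R) ≠ ⊤ := by
      intro h
      have := infinite_iff.2 (hRκ ▸ hκ)
      have := subsingleton_of_bot_eq_top h
      exact not_subsingleton R this
    have hfork (Z : Type u) : forkIndex ((Z → Bool) × R) = κ := by
      rw [forkIndex_prod, hRe, hRκ, hsq]
    refine ⟨fun Z _ => ⟨representable_prod Z R, mk_idealElements_prod hR.1 hne, hfork Z,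
      fun hZ => ?_⟩, fun Z Z' _ _ hZZ' h => hZZ' (mk_eq_of_isomorphic_prod hR.1 hne h)⟩
    have hcard : #((Z → Bool) × R) = κ := by
      have hpow : #(Z → Bool) = 2 ^ #Z := by simp
      rw [← mul_def, hRκ, hpow]
      exact mul_eq_right hκ hZ (power_ne_zero _ two_ne_zero)
    exact ⟨hcard, by rw [Explosive, hfork, hcard, hsq]⟩
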